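/- Let $\mathbf K$ be $\mathbf R$ or $\mathbf C$, let $X$ be a normed space over $\mathbf K$ with dual space $X^*$, and for a function $g\colon X\to\mathbf K$ put $\|g\|=\sup_{\|x\|\le 1}|g(x)|$. For $n\in\mathbf N$ let $$c_n(X)=\inf\Big\{M\in[0,\infty] : \prod_{j=1}^n\|f_j\|\le M\,\Big\|\prod_{j=1}^n f_j\Big\|\ \text{ for all } f_1,\dots,f_n\in X^*\Big\}$$ be the $n$-th linear polarization constant of $X$, where $\prod_j f_j$ denotes the pointwise product $x\mapsto\prod_j f_j(x)$. Then the limit $$c(X)=\lim_{n\to\infty}c_n(X)^{1/n}$$ exists in $[0,\infty]$, and $c(X)=\infty$ if and only if $X$ is infinite dimensional over $\mathbf K$. -/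

import Mathlib

open Filter Topology
open scoped ENNReal

noncomputable section

/-- The sup norm `‖f‖ = sup_{‖x‖ ≤ 1} |f x|`, as an element of `[0, ∞]`, of a scalar function on a
normed space. -/
def unitBallSupNorm {𝕜 X : Type*} [RCLike 𝕜] [NormedAddCommGroup X] (f : X → 𝕜) : ℝ≥0∞ :=
  ⨆ x ∈ Metric.closedBall (0 : X) 1, ‖f x‖ₑ

/-- The `n`-th linear polarization constant `c_n(X)`: the infimum of all `M ≥ 0` such that
`∏ ‖f_j‖ ≤ M * ‖∏ f_j‖` for all `f_1, …, f_n` in the dual space of `X`. -/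
def nthPolarizationConst (𝕜 X : Type*) [RCLike 𝕜] [NormedAddCommGroup X] [NormedSpace 𝕜 X]
    (n : ℕ) : ℝ≥0∞ :=
  sInf {M : ℝ≥0∞ | ∀ f : Fin n → StrongDual 𝕜 X,
    ∏ j, ‖f j‖ₑ ≤ M * unitBallSupNorm (fun x : X => ∏ j, f j x)}

/-- The linear polarization constant `c(X)`, as the upper limit in `[0, ∞]` of `c_n(X)^(1/n)`
(a definition that makes sense before the limit is known to exist). -/
def polarizationConst (𝕜 X : Type*) [RCLike 𝕜] [NormedAddCommGroup X] [NormedSpace 𝕜 X] : ℝ≥0∞ :=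
  limsup (fun n : ℕ => nthPolarizationConst 𝕜 X n ^ (1 / (n : ℝ))) atTop

end

/-! Concatenating families of functionals makes `c_n` supermultiplicative, so for nontrivial `X` the
limit exists and equals the supremum of `c_n ^ (1/n)`, as in Fekete's lemma. In finite dimension,
restrict the functionals to a trigonometric curve through a basis. Each becomes a polynomial on the
unit circle whose Mahler measure controls its norm. Mahler measure is multiplicative and at most the
sup on the circle, so `c_n ≤ C ^ n`. In infinite dimension, take a subspace of the dual of large
dimension `d` and a finite net of functionals on it. Unit vectors are chosen greedily: by a trace
argument (`exists_norm_eq_one_sum_mul_norm_sq_le`), each new one can have weighted mean square at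
most `1/d` over the net. The products then decay like `m ^ (-n)` for any prescribed `m`, so `c_n ≥ m
^ n` for some `n`. -/

/-! ### Mahler measure and the finite-dimensional upper bound -/

open Polynomial in
theorem Polynomial.mahlerMeasure_le_of_forall_norm_eval_le (p : ℂ[X]) {B : ℝ} (hB : 0 ≤ B)
    (h : ∀ θ : ℝ, ‖p.eval (circleMap 0 1 θ)‖ ≤ B) : p.mahlerMeasure ≤ B := by
  -- By Parseval, the `ℓ²` norm of the coefficients is the `L²` norm on the circle, hence at most
  -- the sup.
  refine p.mahlerMeasure_le_sqrt_sum_sq_norm_coeff.trans (Real.sqrt_le_iff.2 ⟨hB, ?_⟩)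
  have key := p.sum_sq_norm_coeff_eq_circleAverage
  have hsum : (∑ i ∈ p.support, ‖p.coeff i‖ ^ 2) =
      Real.circleAverage (fun z ↦ ‖p.eval z‖ ^ 2) 0 1 := by
    simpa [Polynomial.sum_def] using key
  rw [hsum]
  refine Real.circleAverage_mono_on_of_le_circle ?_ ?_
  · apply ContinuousOn.circleIntegrable (by norm_num)
    fun_prop
  · intro z hz
    obtain ⟨θ, -, rfl⟩ : z ∈ circleMap 0 1 '' Set.Ioc 0 (2 * Real.pi) := by
      rw [image_circleMap_Ioc]; simpa using hz
    exact pow_le_pow_left₀ (norm_nonneg _) (h θ) 2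

/-- The polynomial `z ^ d * ∑ k, a k * (z ^ (k + 1) + z ^ (-(k + 1)))` attached to a cosine sum. -/
noncomputable def cosPolynomial {d : ℕ} (a : Fin d → ℂ) : Polynomial ℂ :=
  ∑ k, Polynomial.C (a k) * (Polynomial.X ^ (d + (k + 1 : ℕ)) + Polynomial.X ^ (d - (k + 1 : ℕ)))

theorem coeff_cosPolynomial {d : ℕ} (a : Fin d → ℂ) (k : Fin d) :
    (cosPolynomial a).coeff (d + (k + 1 : ℕ)) = a k := by
  simp only [cosPolynomial, Polynomial.finsetSum_coeff, Polynomial.coeff_C_mul,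
    Polynomial.coeff_add, Polynomial.coeff_X_pow]
  rw [Finset.sum_eq_single k]
  · rw [if_pos rfl, if_neg (by omega)]; simp
  · intro j _ hj
    have : (j : ℕ) ≠ k := fun h => hj (Fin.ext h)
    rw [if_neg (by omega), if_neg (by omega)]; simp
  · simp

theorem natDegree_cosPolynomial_le {d : ℕ} (a : Fin d → ℂ) :
    (cosPolynomial a).natDegree ≤ 2 * d := by
  refine Polynomial.natDegree_sum_le_of_forall_le _ _ fun k _ => ?_
  refine (Polynomial.natDegree_C_mul_le _ _).trans (Polynomial.natDegree_add_le_of_degree_le ?_ ?_) <;>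
  · rw [Polynomial.natDegree_X_pow]; omega

theorem norm_eval_cosPolynomial {d : ℕ} (a : Fin d → ℂ) (θ : ℝ) :
    ‖(cosPolynomial a).eval (circleMap 0 1 θ)‖ =
      ‖∑ k : Fin d, ((2 * Real.cos ((k + 1 : ℕ) * θ) : ℝ) : ℂ) * a k‖ := by
  have hz : circleMap 0 1 θ = Complex.exp (θ * Complex.I) := by simp [circleMap]
  have : (cosPolynomial a).eval (circleMap 0 1 θ) = Complex.exp (θ * Complex.I) ^ d *
      ∑ k : Fin d, ((2 * Real.cos ((k + 1 : ℕ) * θ) : ℝ) : ℂ) * a k := by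
    rw [hz, cosPolynomial, Polynomial.eval_finsetSum, Finset.mul_sum]
    refine Finset.sum_congr rfl fun k _ => ?_
    have h1 : ((2 * Real.cos ((k + 1 : ℕ) * θ) : ℝ) : ℂ) =
        Complex.exp (θ * Complex.I) ^ (k + 1 : ℕ) +
          (Complex.exp (θ * Complex.I) ^ (k + 1 : ℕ))⁻¹ := by
      rw [← Complex.exp_nat_mul, ← Complex.exp_neg]
      push_cast
      rw [Complex.two_cos]
      congr 2
      all_goals ring_nf
    rw [h1]
    simp only [Polynomial.eval_mul, Polynomial.eval_C, Polynomial.eval_add, Polynomial.eval_pow,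
      Polynomial.eval_X]
    rw [pow_sub₀ _ (Complex.exp_ne_zero _) (by omega : (k + 1 : ℕ) ≤ d), pow_add,
      ← mul_add, mul_comm, mul_assoc]
  rw [this, norm_mul, norm_pow, Complex.norm_exp_ofReal_mul_I, one_pow, one_mul]

theorem norm_le_mahlerMeasure_cosPolynomial {d : ℕ} (a : Fin d → ℂ) (k : Fin d) :
    ‖a k‖ ≤ 4 ^ d * (cosPolynomial a).mahlerMeasure := by
  have h := (cosPolynomial a).norm_coeff_le_choose_mul_mahlerMeasure (d + (k + 1 : ℕ))
  rw [coeff_cosPolynomial] at h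
  refine h.trans ?_
  have h0 : 0 ≤ (cosPolynomial a).mahlerMeasure := Polynomial.mahlerMeasure_nonneg _
  gcongr
  calc (((cosPolynomial a).natDegree.choose (d + (k + 1 : ℕ)) : ℕ) : ℝ)
      ≤ ((2 ^ (cosPolynomial a).natDegree : ℕ) : ℝ) := by
        exact_mod_cast Nat.choose_le_two_pow _ _
    _ ≤ ((2 ^ (2 * d) : ℕ) : ℝ) := by
        exact_mod_cast Nat.pow_le_pow_right (by norm_num) (natDegree_cosPolynomial_le a)
    _ = 4 ^ d := by push_cast; rw [pow_mul]; norm_num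

theorem exists_prod_norm_le_of_finiteDimensional (𝕜 X : Type*) [RCLike 𝕜] [NormedAddCommGroup X]
    [NormedSpace 𝕜 X] [FiniteDimensional 𝕜 X] :
    ∃ C : ℝ, 0 ≤ C ∧ ∀ (n : ℕ) (f : Fin n → StrongDual 𝕜 X) (B : ℝ), 0 ≤ B →
      (∀ x : X, ‖x‖ ≤ 1 → ∏ j, ‖f j x‖ ≤ B) → ∏ j, ‖f j‖ ≤ C ^ n * B := by
  let b := Module.finBasis 𝕜 X
  set d := Module.finrank 𝕜 X
  obtain ⟨K, hK, hbK⟩ := b.exists_opNorm_le (F := 𝕜)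
  set R : ℝ := 1 + ∑ k, 2 * ‖b k‖ with hR
  have hR0 : 0 < R := by positivity
  refine ⟨K * 4 ^ d * R, by positivity, fun n f B hB hf => ?_⟩
  -- Cosines, rather than powers of `z`, keep the curve inside `X` when the scalars are real.
  let x : ℝ → X := fun θ => ∑ k : Fin d, ((2 * Real.cos ((k + 1 : ℕ) * θ) : ℝ) : 𝕜) • b k
  have hx : ∀ θ, ‖x θ‖ ≤ R := fun θ => by
    refine (norm_sum_le _ _).trans (le_trans ?_ (le_add_of_nonneg_left zero_le_one))
    refine Finset.sum_le_sum fun k _ => ?_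
    rw [norm_smul, RCLike.norm_ofReal, abs_mul, abs_two]
    gcongr
    exact mul_le_of_le_one_right zero_le_two (Real.abs_cos_le_one _)
  let p : Fin n → Polynomial ℂ := fun j => cosPolynomial fun k => RCLike.map 𝕜 ℂ (f j (b k))
  have hnorm : ∀ a : 𝕜, ‖RCLike.map 𝕜 ℂ a‖ = ‖a‖ := fun a => by
    simp
  have heval : ∀ j θ, ‖(p j).eval (circleMap 0 1 θ)‖ = ‖f j (x θ)‖ := fun j θ => by
    rw [norm_eval_cosPolynomial, ← hnorm (f j (x θ)), map_sum, map_sum]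
    congr 1
    refine Finset.sum_congr rfl fun k _ => ?_
    rw [map_smul, smul_eq_mul, ← RCLike.real_smul_eq_coe_mul, map_smul, Complex.real_smul]
  have hle : ∀ j, ‖f j‖ ≤ K * (4 ^ d * (p j).mahlerMeasure) := fun j =>
    hbK (mul_nonneg (by positivity) (Polynomial.mahlerMeasure_nonneg _)) fun k => by
      rw [← hnorm]
      exact norm_le_mahlerMeasure_cosPolynomial (fun k => RCLike.map 𝕜 ℂ (f j (b k))) k
  have hM : ∏ j, (p j).mahlerMeasure ≤ R ^ n * B := by
    have h1 : ∏ j, (p j).mahlerMeasure = (∏ j, p j).mahlerMeasure := by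
      have := Polynomial.prod_mahlerMeasure_eq_mahlerMeasure_prod (Finset.univ.val.map p)
      rw [Multiset.map_map] at this
      exact this.symm
    rw [h1]
    refine Polynomial.mahlerMeasure_le_of_forall_norm_eval_le _ (by positivity) fun θ => ?_
    rw [Polynomial.eval_prod, norm_prod, Finset.prod_congr rfl fun j _ => heval j θ]
    have h2 := hf (((R⁻¹ : ℝ) : 𝕜) • x θ) (by
      rw [norm_smul, RCLike.norm_ofReal, abs_of_pos (inv_pos.2 hR0)]
      exact inv_mul_le_one_of_le₀ (hx θ) hR0.le)
    simp only [map_smul, norm_smul, RCLike.norm_ofReal, abs_of_pos (inv_pos.2 hR0),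
      Finset.prod_mul_distrib, Finset.prod_const, Finset.card_univ, Fintype.card_fin, inv_pow] at h2
    rwa [inv_mul_le_iff₀ (by positivity)] at h2
  calc ∏ j, ‖f j‖ ≤ ∏ j, K * (4 ^ d * (p j).mahlerMeasure) :=
        Finset.prod_le_prod (fun _ _ => norm_nonneg _) fun j _ => hle j
    _ = (K * 4 ^ d) ^ n * ∏ j, (p j).mahlerMeasure := by
        simp [Finset.prod_mul_distrib, mul_pow, mul_assoc]
    _ ≤ (K * 4 ^ d) ^ n * (R ^ n * B) := by gcongr
    _ = (K * 4 ^ d * R) ^ n * B := by rw [mul_pow _ R, mul_assoc]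

/-! ### Greedy choice of vectors and the infinite-dimensional lower bound -/

/-- If it failed, the Hilbertian norm `‖T f‖` would strictly dominate `√(W / d) * ‖f‖` for `f ≠ 0`.
Dually, the squared Hilbertian norm `s i` of each `φ i` would satisfy `W * s i < d`. But the
weighted sum of the `s i` is the trace `d`, so averaging gives `W * d < W * d`. -/
theorem exists_norm_eq_one_sum_mul_norm_sq_le {𝕜 E ι : Type*} [RCLike 𝕜] [NormedAddCommGroup E]
    [NormedSpace 𝕜 E] [Fintype ι] (hE : 0 < Module.finrank 𝕜 E) (φ : ι → StrongDual 𝕜 E)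
    (hφ : ∀ i, ‖φ i‖ ≤ 1) (w : ι → ℝ) (hw : ∀ i, 0 ≤ w i) :
    ∃ f : E, ‖f‖ = 1 ∧ Module.finrank 𝕜 E * ∑ i, w i * ‖φ i f‖ ^ 2 ≤ ∑ i, w i := by
  have : FiniteDimensional 𝕜 E := Module.finite_of_finrank_pos hE
  by_contra! hcon
  set d := Module.finrank 𝕜 E with hd
  set W := ∑ i, w i with hWdef
  have hW : 0 ≤ W := Finset.sum_nonneg fun i _ => hw i
  let T : E →ₗ[𝕜] EuclideanSpace 𝕜 ι :=
    { toFun := fun f => WithLp.toLp 2 fun i => ((Real.sqrt (w i) : ℝ) : 𝕜) * φ i f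
      map_add' := fun f g => by ext i; simp [mul_add]
      map_smul' := fun c f => by ext i; simp [mul_left_comm] }
  have hT : ∀ f : E, ‖T f‖ ^ 2 = ∑ i, w i * ‖φ i f‖ ^ 2 := fun f => by
    rw [EuclideanSpace.norm_sq_eq]
    refine Finset.sum_congr rfl fun i _ => ?_
    change ‖((Real.sqrt (w i) : ℝ) : 𝕜) * φ i f‖ ^ 2 = _
    rw [norm_mul, mul_pow, RCLike.norm_ofReal, sq_abs, Real.sq_sqrt (hw i)]
  have hlow : ∀ f : E, f ≠ 0 → W * ‖f‖ ^ 2 < d * ‖T f‖ ^ 2 := fun f hf => by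
    have hn : 0 < ‖f‖ := norm_pos_iff.2 hf
    have h := hcon (((‖f‖⁻¹ : ℝ) : 𝕜) • f) (by
      rw [norm_smul, RCLike.norm_ofReal, abs_of_pos (inv_pos.2 hn)]
      exact inv_mul_cancel₀ hn.ne')
    rw [← hT, map_smul, norm_smul, RCLike.norm_ofReal, abs_of_pos (inv_pos.2 hn)] at h
    calc W * ‖f‖ ^ 2 < d * (‖f‖⁻¹ * ‖T f‖) ^ 2 * ‖f‖ ^ 2 := by gcongr
      _ = d * ‖T f‖ ^ 2 := by field_simp
  have hinj : Function.Injective T := by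
    refine (injective_iff_map_eq_zero T).2 fun f hf => ?_
    by_contra h0
    have := hlow f h0
    rw [hf, norm_zero] at this
    nlinarith [mul_nonneg hW (sq_nonneg ‖f‖)]
  let b := stdOrthonormalBasis 𝕜 (LinearMap.range T)
  have hrank : Module.finrank 𝕜 (LinearMap.range T) = d := LinearMap.finrank_range_of_inj hinj
  have hex : ∀ k, ∃ h : E, T h = b k := fun k => LinearMap.mem_range.1 (b k).2
  choose h hh using hex
  have hbo : Orthonormal 𝕜 fun k => T (h k) := by
    simp only [hh]
    exact b.orthonormal.comp_linearIsometry (LinearMap.range T).subtypeₗᵢ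
  let s : ι → ℝ := fun i => ∑ k, ‖φ i (h k)‖ ^ 2
  have hs : ∀ i, W * s i < d := fun i => by
    have hs0 : 0 ≤ s i := Finset.sum_nonneg fun _ _ => sq_nonneg _
    -- The Riesz representative of `φ i` for the inner product pulled back by `T`.
    let g : E := ∑ k, (starRingEnd 𝕜) (φ i (h k)) • h k
    have hTg : ‖T g‖ ^ 2 = s i := by
      have h1 : T g = ∑ k, (starRingEnd 𝕜) (φ i (h k)) • T (h k) := by
        simp [g, map_sum]
      have h2 : (inner 𝕜 (T g) (T g) : 𝕜) = ((s i : ℝ) : 𝕜) := by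
        rw [h1, hbo.inner_sum]
        simp only [s, RCLike.conj_conj, map_sum, map_pow]
        refine Finset.sum_congr rfl fun k _ => ?_
        exact RCLike.mul_conj _
      rw [inner_self_eq_norm_sq_to_K] at h2
      exact_mod_cast h2
    have hgx : φ i g = ((s i : ℝ) : 𝕜) := by
      simp only [g, map_smul, smul_eq_mul, s, map_sum, map_pow]
      exact Finset.sum_congr rfl fun k _ => RCLike.conj_mul _
    have hsg : s i ≤ ‖g‖ := by
      calc s i = ‖φ i g‖ := by rw [hgx, RCLike.norm_ofReal, abs_of_nonneg hs0]
        _ ≤ ‖φ i‖ * ‖g‖ := ContinuousLinearMap.le_opNorm _ _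
        _ ≤ ‖g‖ := mul_le_of_le_one_left (norm_nonneg _) (hφ i)
    rcases hs0.eq_or_lt with h0 | h0
    · rw [← h0, mul_zero]; exact_mod_cast hE
    · have hg : g ≠ 0 := norm_pos_iff.1 (h0.trans_le hsg)
      have h1 := hlow g hg
      rw [hTg] at h1
      have h2 : W * s i * s i < d * s i := by
        refine lt_of_le_of_lt ?_ h1
        rw [mul_assoc, ← sq]
        gcongr
      exact lt_of_mul_lt_mul_right h2 h0.le
  have hsum : ∑ i, w i * s i = d := by
    calc ∑ i, w i * s i = ∑ k, ‖T (h k)‖ ^ 2 := by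
          simp only [s, Finset.mul_sum, hT]
          exact Finset.sum_comm
      _ = d := by simp [hbo.norm_eq_one, hrank]
  have hdW : ∑ i, w i * (W * s i) = W * d := by
    rw [← hsum, Finset.mul_sum]
    exact Finset.sum_congr rfl fun i _ => by ring
  by_cases hz : ∃ i, 0 < w i
  · obtain ⟨i, hi⟩ := hz
    have : ∑ i, w i * (W * s i) < ∑ i, w i * d :=
      Finset.sum_lt_sum (fun i _ => mul_le_mul_of_nonneg_left (hs i).le (hw i))
        ⟨i, Finset.mem_univ i, mul_lt_mul_of_pos_left (hs i) hi⟩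
    rw [hdW, ← Finset.sum_mul] at this
    exact lt_irrefl _ this
  · push Not at hz
    have h0 : ∑ i, w i * s i = 0 :=
      Finset.sum_eq_zero fun i _ => by rw [le_antisymm (hz i) (hw i), zero_mul]
    rw [hsum] at h0
    exact hE.ne' (by exact_mod_cast h0)

theorem exists_finset_dual_forall_norm_apply_le (𝕜 E : Type*) [RCLike 𝕜] [NormedAddCommGroup E]
    [NormedSpace 𝕜 E] [FiniteDimensional 𝕜 E] {δ : ℝ} (hδ : 0 < δ) :
    ∃ t : Finset (StrongDual 𝕜 E), (∀ ψ ∈ t, ‖ψ‖ ≤ 1) ∧ ∀ φ : StrongDual 𝕜 E, ‖φ‖ ≤ 1 →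
      ∃ ψ ∈ t, ∀ f : E, ‖f‖ = 1 → ‖φ f‖ ≤ ‖ψ f‖ + δ := by
  have : ProperSpace (StrongDual 𝕜 E) := FiniteDimensional.proper 𝕜 _
  obtain ⟨t, ht, htf, hcov⟩ := Metric.finite_approx_of_totallyBounded
    (isCompact_closedBall (0 : StrongDual 𝕜 E) 1).totallyBounded δ hδ
  refine ⟨htf.toFinset, fun ψ hψ => mem_closedBall_zero_iff.1 (ht (htf.mem_toFinset.1 hψ)),
    fun φ hφ => ?_⟩
  obtain ⟨ψ, hψ, hφψ⟩ := Set.mem_iUnion₂.1 (hcov (mem_closedBall_zero_iff.2 hφ))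
  refine ⟨ψ, htf.mem_toFinset.2 hψ, fun f hf => ?_⟩
  have h1 : ‖φ f - ψ f‖ ≤ δ := by
    have h2 := (φ - ψ).le_opNorm f
    rw [hf, mul_one] at h2
    exact h2.trans (mem_ball_iff_norm.1 hφψ).le
  have h3 := norm_sub_norm_le (φ f) (ψ f)
  linarith

/-- The weights for the next choice are the products already accumulated; the summand `δ` leaves
room for the net error. -/
theorem exists_sum_prod_norm_add_sq_le {𝕜 E ι : Type*} [RCLike 𝕜] [NormedAddCommGroup E]
    [NormedSpace 𝕜 E] [Fintype ι] (hE : 0 < Module.finrank 𝕜 E) (φ : ι → StrongDual 𝕜 E)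
    (hφ : ∀ i, ‖φ i‖ ≤ 1) (δ : ℝ) (n : ℕ) :
    ∃ f : Fin n → E, (∀ j, ‖f j‖ = 1) ∧
      ∑ i, ∏ j, (‖φ i (f j)‖ + δ) ^ 2 ≤
        (2 * ((Module.finrank 𝕜 E : ℝ)⁻¹ + δ ^ 2)) ^ n * Fintype.card ι := by
  induction n with
  | zero => exact ⟨Fin.elim0, fun j => j.elim0, by simp⟩
  | succ n ih =>
    obtain ⟨f, hf, hsum⟩ := ih
    have hd0 : (0 : ℝ) < Module.finrank 𝕜 E := by exact_mod_cast hE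
    set d : ℝ := (Module.finrank 𝕜 E : ℝ) with hd
    let w : ι → ℝ := fun i => ∏ j, (‖φ i (f j)‖ + δ) ^ 2
    have hw : ∀ i, 0 ≤ w i := fun i => Finset.prod_nonneg fun _ _ => sq_nonneg _
    obtain ⟨g, hg1, hg⟩ := exists_norm_eq_one_sum_mul_norm_sq_le hE φ hφ w hw
    rw [← hd] at hg
    refine ⟨Fin.cons g f, Fin.cases hg1 hf, ?_⟩
    simp only [Fin.prod_univ_succ, Fin.cons_zero, Fin.cons_succ]
    calc ∑ i, (‖φ i g‖ + δ) ^ 2 * w i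
        ≤ ∑ i, 2 * (w i * ‖φ i g‖ ^ 2 + δ ^ 2 * w i) := by
          refine Finset.sum_le_sum fun i _ => ?_
          calc (‖φ i g‖ + δ) ^ 2 * w i ≤ 2 * (‖φ i g‖ ^ 2 + δ ^ 2) * w i :=
                mul_le_mul_of_nonneg_right add_sq_le (hw i)
            _ = _ := by ring
      _ = 2 * (∑ i, w i * ‖φ i g‖ ^ 2 + δ ^ 2 * ∑ i, w i) := by
          rw [← Finset.mul_sum, Finset.sum_add_distrib, Finset.mul_sum]
      _ ≤ 2 * (d⁻¹ * ∑ i, w i + δ ^ 2 * ∑ i, w i) := by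
          gcongr
          rwa [le_inv_mul_iff₀ hd0]
      _ = 2 * (d⁻¹ + δ ^ 2) * ∑ i, w i := by ring
      _ ≤ 2 * (d⁻¹ + δ ^ 2) * ((2 * (d⁻¹ + δ ^ 2)) ^ n * Fintype.card ι) := by gcongr
      _ = _ := by ring

theorem exists_submodule_finrank_eq {𝕜 G : Type*} [Field 𝕜] [AddCommGroup G] [Module 𝕜 G]
    (hG : ¬ FiniteDimensional 𝕜 G) (d : ℕ) : ∃ F : Submodule 𝕜 G, Module.finrank 𝕜 F = d := by
  have hrank : (d : Cardinal) ≤ Module.rank 𝕜 G := by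
    rw [FiniteDimensional, ← Module.rank_lt_aleph0_iff, not_lt] at hG
    exact (Cardinal.natCast_lt_aleph0).le.trans hG
  obtain ⟨v, hv⟩ := Module.le_rank_iff.1 hrank
  exact ⟨Submodule.span 𝕜 (Set.range v), by simpa using finrank_span_eq_card hv⟩

theorem exists_prod_norm_dual_apply_le_inv_pow_of_finrank_eq {𝕜 E : Type*} [RCLike 𝕜]
    [NormedAddCommGroup E] [NormedSpace 𝕜 E] {m : ℕ} (hm : 0 < m)
    (hE : Module.finrank 𝕜 E = 16 * m ^ 2) :
    ∃ n, 0 < n ∧ ∃ f : Fin n → E, (∀ j, ‖f j‖ = 1) ∧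
      ∀ φ : StrongDual 𝕜 E, ‖φ‖ ≤ 1 → ∏ j, ‖φ (f j)‖ ≤ ((m : ℝ)⁻¹) ^ n := by
  have hm' : (0 : ℝ) < m := by exact_mod_cast hm
  have hE0 : 0 < Module.finrank 𝕜 E := by rw [hE]; positivity
  have : FiniteDimensional 𝕜 E := Module.finite_of_finrank_pos hE0
  obtain ⟨δ, hδ⟩ : ∃ δ : ℝ, δ = (4 * m : ℝ)⁻¹ := ⟨_, rfl⟩
  have hδ0 : 0 < δ := by rw [hδ]; positivity
  have hδm : 2 * ((Module.finrank 𝕜 E : ℝ)⁻¹ + δ ^ 2) = 4⁻¹ * (m : ℝ)⁻¹ ^ 2 := by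
    rw [hE, hδ]
    push_cast
    field_simp
    norm_num
  obtain ⟨t, ht, hcov⟩ := exists_finset_dual_forall_norm_apply_le 𝕜 E hδ0
  -- The dimension and `δ` leave a spare factor `1/4` per step, which absorbs the size of the net.
  obtain ⟨n, hn⟩ : ∃ n : ℕ, (t.card : ℝ) ≤ 4 ^ (n + 1) := by
    obtain ⟨n, hn⟩ := pow_unbounded_of_one_lt (t.card : ℝ) (by norm_num : (1 : ℝ) < 4)
    exact ⟨n, hn.le.trans (pow_le_pow_right₀ (by norm_num) n.le_succ)⟩
  obtain ⟨f, hf, hsum⟩ := exists_sum_prod_norm_add_sq_le hE0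
    (fun ψ : t => (ψ : StrongDual 𝕜 E)) (fun ψ => ht ψ ψ.2) δ (n + 1)
  rw [hδm, Fintype.card_coe, Finset.sum_coe_sort t fun ψ => ∏ j, (‖ψ (f j)‖ + δ) ^ 2] at hsum
  refine ⟨n + 1, n.succ_pos, f, hf, fun φ hφ => ?_⟩
  obtain ⟨ψ, hψ, hφψ⟩ := hcov φ hφ
  refine le_of_sq_le_sq ?_ (by positivity)
  calc (∏ j, ‖φ (f j)‖) ^ 2 = ∏ j, ‖φ (f j)‖ ^ 2 := (Finset.prod_pow _ _ _).symm
    _ ≤ ∏ j, (‖ψ (f j)‖ + δ) ^ 2 := by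
        refine Finset.prod_le_prod (fun _ _ => sq_nonneg _) fun j _ => ?_
        exact pow_le_pow_left₀ (norm_nonneg _) (hφψ _ (hf j)) 2
    _ ≤ ∑ ψ ∈ t, ∏ j, (‖ψ (f j)‖ + δ) ^ 2 :=
        Finset.single_le_sum (f := fun ψ : StrongDual 𝕜 E => ∏ j, (‖ψ (f j)‖ + δ) ^ 2)
          (fun _ _ => Finset.prod_nonneg fun _ _ => sq_nonneg _) hψ
    _ ≤ (4⁻¹ * (m : ℝ)⁻¹ ^ 2) ^ (n + 1) * t.card := hsum
    _ ≤ (4⁻¹ * (m : ℝ)⁻¹ ^ 2) ^ (n + 1) * 4 ^ (n + 1) := by gcongr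
    _ = ((m : ℝ)⁻¹ ^ (n + 1)) ^ 2 := by
        rw [← mul_pow, mul_right_comm, inv_mul_cancel₀ four_ne_zero, one_mul, pow_right_comm]

theorem exists_prod_norm_dual_apply_le_inv_pow {𝕜 G : Type*} [RCLike 𝕜] [NormedAddCommGroup G]
    [NormedSpace 𝕜 G] (hG : ¬ FiniteDimensional 𝕜 G) {m : ℕ} (hm : 0 < m) :
    ∃ n, 0 < n ∧ ∃ f : Fin n → G, (∀ j, ‖f j‖ = 1) ∧
      ∀ φ : StrongDual 𝕜 G, ‖φ‖ ≤ 1 → ∏ j, ‖φ (f j)‖ ≤ ((m : ℝ)⁻¹) ^ n := by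
  obtain ⟨F, hF⟩ := exists_submodule_finrank_eq hG (16 * m ^ 2)
  obtain ⟨n, hn, f, hf, h⟩ := exists_prod_norm_dual_apply_le_inv_pow_of_finrank_eq hm hF
  refine ⟨n, hn, fun j => f j, hf, fun φ hφ => h (φ.comp F.subtypeL) <|
    ContinuousLinearMap.opNorm_le_bound _ zero_le_one fun f => ?_⟩
  rw [one_mul]
  exact (φ.le_opNorm _).trans (mul_le_of_le_one_left (norm_nonneg _) hφ)

/-- Points of the unit ball of `X` act as functionals of norm at most one on the dual, so the vector
version applies there. -/
theorem exists_prod_norm_apply_le_inv_pow {𝕜 X : Type*} [RCLike 𝕜] [NormedAddCommGroup X]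
    [NormedSpace 𝕜 X] (hX : ¬ FiniteDimensional 𝕜 X) {m : ℕ} (hm : 0 < m) :
    ∃ n, 0 < n ∧ ∃ f : Fin n → StrongDual 𝕜 X, (∀ j, ‖f j‖ = 1) ∧
      ∀ x, ‖x‖ ≤ 1 → ∏ j, ‖f j x‖ ≤ ((m : ℝ)⁻¹) ^ n := by
  have hdual : ¬ FiniteDimensional 𝕜 (StrongDual 𝕜 X) := fun h => hX <|
    FiniteDimensional.of_injective (NormedSpace.inclusionInDoubleDualLi 𝕜 (E := X)).toLinearMap
      (NormedSpace.inclusionInDoubleDualLi 𝕜 (E := X)).injective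
  obtain ⟨n, hn, f, hf, h⟩ := exists_prod_norm_dual_apply_le_inv_pow hdual hm
  exact ⟨n, hn, f, hf, fun x hx => h (NormedSpace.inclusionInDoubleDualLi 𝕜 x)
    (((NormedSpace.inclusionInDoubleDualLi 𝕜).norm_map x).trans_le hx)⟩

/-! ### Fekete's lemma in `[0, ∞]` -/

theorem ENNReal.tendsto_rpow_one_div_of_supermultiplicative {a : ℕ → ℝ≥0∞} (h1 : ∀ n, 1 ≤ a n)
    (hmul : ∀ m n, a m * a n ≤ a (m + n)) :
    Tendsto (fun n : ℕ => a n ^ (1 / (n : ℝ))) atTop (𝓝 (⨆ n : ℕ, a n ^ (1 / (n : ℝ)))) := by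
  refine tendsto_order.2 ⟨fun L hL => ?_, fun L hL => Eventually.of_forall fun n =>
    (le_iSup (fun n : ℕ => a n ^ (1 / (n : ℝ))) n).trans_lt hL⟩
  obtain ⟨m, hm⟩ := lt_iSup_iff.1 hL
  -- Since `1 / 0 = 0`, the term of index `0` is `1`; this is harmless because every `a n ≥ 1`.
  rcases Nat.eq_zero_or_pos m with rfl | hm0
  · refine Eventually.of_forall fun n => hm.trans_le ?_
    rw [Nat.cast_zero, _root_.div_zero, ENNReal.rpow_zero]
    exact (ENNReal.one_rpow _).symm.trans_le (ENNReal.rpow_le_rpow (h1 n) (by positivity))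
  have hpow : ∀ q r : ℕ, a m ^ q ≤ a (q * m + r) := fun q r => by
    induction q with
    | zero => simpa using h1 r
    | succ q ih =>
      calc a m ^ (q + 1) ≤ a m * a (q * m + r) := by rw [pow_succ']; gcongr
        _ ≤ a (m + (q * m + r)) := hmul _ _
        _ = a ((q + 1) * m + r) := by congr 1; ring
  have hlow : ∀ n : ℕ, a m ^ (((n / m : ℕ) : ℝ) / n) ≤ a n ^ (1 / (n : ℝ)) := fun n => by
    have h := hpow (n / m) (n % m)
    rw [Nat.div_add_mod'] at h
    calc a m ^ (((n / m : ℕ) : ℝ) / n) = (a m ^ (n / m)) ^ (1 / (n : ℝ)) := by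
          rw [← ENNReal.rpow_natCast, ← ENNReal.rpow_mul, mul_one_div]
      _ ≤ a n ^ (1 / (n : ℝ)) := ENNReal.rpow_le_rpow h (by positivity)
  have hlim : Tendsto (fun n : ℕ => ((n / m : ℕ) : ℝ) / n) atTop (𝓝 (1 / (m : ℝ))) := by
    have := (tendsto_nat_floor_mul_div_atTop (R := ℝ) (a := 1 / m) (by positivity)).comp
      tendsto_natCast_atTop_atTop
    refine this.congr fun n => ?_
    simp only [Function.comp_apply]
    rw [one_div_mul_eq_div, Nat.floor_div_natCast, Nat.floor_natCast]
  rcases eq_or_ne (a m) ∞ with htop | htop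
  · filter_upwards [eventually_ge_atTop m] with n hn
    refine lt_of_lt_of_le ?_ (hlow n)
    have hq : 0 < n / m := Nat.div_pos hn hm0
    have hn0 : 0 < n := hm0.trans_le hn
    rw [htop, ENNReal.top_rpow_of_pos (by positivity)]
    exact hm.trans_le le_top
  · lift a m to NNReal using htop with b hb
    have hb0 : b ≠ 0 := by
      rintro rfl
      have := h1 m
      rw [← hb] at this
      simp at this
    have hcont : Tendsto (fun n : ℕ => (b : ℝ≥0∞) ^ (((n / m : ℕ) : ℝ) / n)) atTop
        (𝓝 ((b : ℝ≥0∞) ^ (1 / (m : ℝ)))) := by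
      simp only [← ENNReal.coe_rpow_of_ne_zero hb0]
      exact ENNReal.tendsto_coe.2 (tendsto_const_nhds.nnrpow hlim (Or.inl hb0))
    filter_upwards [(tendsto_order.1 hcont).1 L hm] with n hn
    exact hn.trans_le (hlow n)

/-! ### Properties of the polarization constants -/

section

variable {𝕜 X : Type*} [RCLike 𝕜] [NormedAddCommGroup X]

theorem unitBallSupNorm_le_iff {f : X → 𝕜} {M : ℝ≥0∞} :
    unitBallSupNorm f ≤ M ↔ ∀ x, ‖x‖ ≤ 1 → ‖f x‖ₑ ≤ M := by
  simp [unitBallSupNorm]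

theorem enorm_le_unitBallSupNorm (f : X → 𝕜) {x : X} (hx : ‖x‖ ≤ 1) :
    ‖f x‖ₑ ≤ unitBallSupNorm f :=
  unitBallSupNorm_le_iff.1 le_rfl x hx

theorem unitBallSupNorm_mul_le (f g : X → 𝕜) :
    unitBallSupNorm (fun x => f x * g x) ≤ unitBallSupNorm f * unitBallSupNorm g :=
  unitBallSupNorm_le_iff.2 fun x hx => by
    rw [enorm_mul]
    exact mul_le_mul' (enorm_le_unitBallSupNorm f hx) (enorm_le_unitBallSupNorm g hx)

theorem enorm_finset_prod {ι : Type*} (s : Finset ι) (a : ι → 𝕜) :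
    ‖∏ j ∈ s, a j‖ₑ = ∏ j ∈ s, ‖a j‖ₑ := by
  induction s using Finset.cons_induction with
  | empty => simp
  | cons i s hi ih => rw [Finset.prod_cons, Finset.prod_cons, enorm_mul, ih]

variable [NormedSpace 𝕜 X]

theorem unitBallSupNorm_prod_le {n : ℕ} (f : Fin n → StrongDual 𝕜 X) :
    unitBallSupNorm (fun x : X => ∏ j, f j x) ≤ ∏ j, ‖f j‖ₑ :=
  unitBallSupNorm_le_iff.2 fun x hx => by
    rw [enorm_finset_prod]
    refine Finset.prod_le_prod' fun j _ => ?_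
    rw [enorm_le_iff_norm_le]
    exact (ContinuousLinearMap.le_opNorm _ _).trans (mul_le_of_le_one_right (norm_nonneg _) hx)

theorem unitBallSupNorm_prod_ne_top {n : ℕ} (f : Fin n → StrongDual 𝕜 X) :
    unitBallSupNorm (fun x : X => ∏ j, f j x) ≠ ∞ :=
  ((unitBallSupNorm_prod_le f).trans_lt
    (ENNReal.prod_lt_top fun _ _ => enorm_lt_top)).ne

/-- The conventions `0 / 0 = 0` and `a / 0 = ∞` for `a ≠ 0` match the constraint on `M` in the
degenerate cases. -/
theorem nthPolarizationConst_eq_iSup (n : ℕ) :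
    nthPolarizationConst 𝕜 X n = ⨆ f : Fin n → StrongDual 𝕜 X,
      (∏ j, ‖f j‖ₑ) / unitBallSupNorm (fun x : X => ∏ j, f j x) := by
  refine le_antisymm ?_ (le_sInf fun M hM => iSup_le fun f => ENNReal.div_le_of_le_mul (hM f))
  by_cases h : ∃ f : Fin n → StrongDual 𝕜 X,
      unitBallSupNorm (fun x : X => ∏ j, f j x) = 0 ∧ ∏ j, ‖f j‖ₑ ≠ 0
  · obtain ⟨f, hf0, hf⟩ := h
    refine le_top.trans (le_trans (le_of_eq ?_) (le_iSup _ f))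
    rw [hf0, ENNReal.div_zero hf]
  · push Not at h
    refine sInf_le fun f => ?_
    by_cases hf0 : unitBallSupNorm (fun x : X => ∏ j, f j x) = 0
    · rw [h f hf0]; exact zero_le
    · rw [← ENNReal.div_le_iff hf0 (unitBallSupNorm_prod_ne_top f)]
      exact le_iSup (fun f : Fin n → StrongDual 𝕜 X =>
        (∏ j, ‖f j‖ₑ) / unitBallSupNorm (fun x : X => ∏ j, f j x)) f

theorem nthPolarizationConst_mul_le (m n : ℕ) :
    nthPolarizationConst 𝕜 X m * nthPolarizationConst 𝕜 X n ≤
      nthPolarizationConst 𝕜 X (m + n) := by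
  simp only [nthPolarizationConst_eq_iSup, ENNReal.iSup_mul, ENNReal.mul_iSup]
  refine iSup_le fun g => iSup_le fun f => le_trans ?_
    (le_iSup (fun h : Fin (m + n) → StrongDual 𝕜 X =>
      (∏ j, ‖h j‖ₑ) / unitBallSupNorm (fun x : X => ∏ j, h j x)) (Fin.append f g))
  simp only [Fin.prod_univ_add, Fin.append_left, Fin.append_right, div_eq_mul_inv]
  calc _ = (∏ j, ‖f j‖ₑ) * (∏ j, ‖g j‖ₑ) * (unitBallSupNorm (fun x : X => ∏ j, f j x) *
        unitBallSupNorm (fun x : X => ∏ j, g j x))⁻¹ := by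
        rw [ENNReal.mul_inv (Or.inr (unitBallSupNorm_prod_ne_top g))
          (Or.inl (unitBallSupNorm_prod_ne_top f)), mul_mul_mul_comm]
    _ ≤ _ := by
        gcongr
        exact unitBallSupNorm_mul_le _ _

theorem one_le_nthPolarizationConst [Nontrivial X] (n : ℕ) : 1 ≤ nthPolarizationConst 𝕜 X n := by
  obtain ⟨x, hx⟩ := exists_ne (0 : X)
  obtain ⟨f, hf, -⟩ := exists_dual_vector 𝕜 x (norm_ne_zero_iff.2 hx)
  have hf' : ‖f‖ₑ = 1 := by rw [← ofReal_norm, hf, ENNReal.ofReal_one]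
  refine le_sInf fun M hM => ?_
  have h := (hM fun _ => f).trans (mul_le_mul_right (unitBallSupNorm_prod_le fun _ => f) M)
  simpa [hf'] using h

theorem nthPolarizationConst_of_subsingleton [Subsingleton X] {n : ℕ} (hn : n ≠ 0) :
    nthPolarizationConst 𝕜 X n = 0 := by
  refine le_antisymm (sInf_le fun f => ?_) zero_le
  have hf : ∀ j, f j = 0 := fun j => by
    ext x
    rw [Subsingleton.elim x 0, map_zero, map_zero]
  have h0 : ‖(0 : StrongDual 𝕜 X)‖ₑ = 0 := by rw [← ofReal_norm, norm_zero, ENNReal.ofReal_zero]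
  simp [hf, hn, h0]

theorem exists_nthPolarizationConst_le_pow [FiniteDimensional 𝕜 X] :
    ∃ C : NNReal, ∀ n, nthPolarizationConst 𝕜 X n ≤ (C : ℝ≥0∞) ^ n := by
  obtain ⟨C, hC, h⟩ := exists_prod_norm_le_of_finiteDimensional 𝕜 X
  lift C to NNReal using hC
  refine ⟨C, fun n => sInf_le fun f => ?_⟩
  have hS := unitBallSupNorm_prod_ne_top f
  have key := h n f (unitBallSupNorm (fun x : X => ∏ j, f j x)).toReal ENNReal.toReal_nonneg
    fun x hx => by
      rw [← norm_prod, ← toReal_enorm]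
      exact ENNReal.toReal_mono hS (enorm_le_unitBallSupNorm (fun x : X => ∏ j, f j x) hx)
  have hne : (C : ℝ≥0∞) ^ n * unitBallSupNorm (fun x : X => ∏ j, f j x) ≠ ∞ :=
    ENNReal.mul_ne_top (ENNReal.pow_ne_top ENNReal.coe_ne_top) hS
  rw [← ENNReal.toReal_le_toReal (ENNReal.prod_lt_top fun _ _ => enorm_lt_top).ne hne]
  simpa [ENNReal.toReal_prod] using key

theorem exists_pow_le_nthPolarizationConst (hX : ¬ FiniteDimensional 𝕜 X) {m : ℕ} (hm : 0 < m) :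
    ∃ n, 0 < n ∧ (m : ℝ≥0∞) ^ n ≤ nthPolarizationConst 𝕜 X n := by
  obtain ⟨n, hn, f, hf, hfx⟩ := exists_prod_norm_apply_le_inv_pow hX hm
  refine ⟨n, hn, le_sInf fun M hM => ?_⟩
  have hf' : ∀ j, ‖f j‖ₑ = 1 := fun j => by rw [← ofReal_norm, hf j, ENNReal.ofReal_one]
  have hS : unitBallSupNorm (fun x : X => ∏ j, f j x) ≤ ((m : ℝ≥0∞) ^ n)⁻¹ :=
    unitBallSupNorm_le_iff.2 fun x hx => by
      rw [← ofReal_norm, norm_prod]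
      refine (ENNReal.ofReal_le_ofReal (hfx x hx)).trans (le_of_eq ?_)
      rw [inv_pow, ENNReal.ofReal_inv_of_pos (by positivity), ENNReal.ofReal_pow (by positivity),
        ENNReal.ofReal_natCast]
  have h := (hM f).trans (mul_le_mul_right hS M)
  simp only [hf', Finset.prod_const_one] at h
  rwa [← div_eq_mul_inv, ENNReal.le_div_iff_mul_le (Or.inl (by positivity))
    (Or.inl (ENNReal.pow_ne_top (ENNReal.natCast_ne_top m))), one_mul] at h

end

/-! ### Existence of the limit and the dichotomy -/

theorem mainTheorem8 (𝕜 X : Type*) [RCLike 𝕜] [NormedAddCommGroup X] [NormedSpace 𝕜 X] :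
    Tendsto (fun n : ℕ => nthPolarizationConst 𝕜 X n ^ (1 / (n : ℝ))) atTop
      (𝓝 (polarizationConst 𝕜 X)) ∧
    (polarizationConst 𝕜 X = ∞ ↔ ¬ FiniteDimensional 𝕜 X) := by
  -- The zero space is separate: there `c_n = 0` for `n ≠ 0`, so the bound `1 ≤ c_n` fails.
  rcases subsingleton_or_nontrivial X with hX | hX
  · have h0 : Tendsto (fun n : ℕ => nthPolarizationConst 𝕜 X n ^ (1 / (n : ℝ))) atTop (𝓝 0) := by
      refine tendsto_const_nhds.congr' ?_
      filter_upwards [eventually_gt_atTop 0] with n hn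
      rw [nthPolarizationConst_of_subsingleton hn.ne', ENNReal.zero_rpow_of_pos (by positivity)]
    have hlim : polarizationConst 𝕜 X = 0 := h0.limsup_eq
    rw [hlim]
    exact ⟨h0, by simpa using (inferInstance : FiniteDimensional 𝕜 X)⟩
  · have hsup := ENNReal.tendsto_rpow_one_div_of_supermultiplicative
      (one_le_nthPolarizationConst (𝕜 := 𝕜) (X := X)) nthPolarizationConst_mul_le
    have hlim : polarizationConst 𝕜 X = ⨆ n : ℕ, nthPolarizationConst 𝕜 X n ^ (1 / (n : ℝ)) :=
      hsup.limsup_eq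
    rw [← hlim] at hsup
    refine ⟨hsup, fun htop hfin => ?_, fun hinf => ?_⟩
    · obtain ⟨C, hC⟩ := exists_nthPolarizationConst_le_pow (𝕜 := 𝕜) (X := X)
      have : polarizationConst 𝕜 X ≤ C := by
        refine le_of_tendsto hsup ?_
        filter_upwards [eventually_gt_atTop 0] with n hn
        rw [one_div]
        exact (ENNReal.rpow_le_rpow (hC n) (by positivity)).trans_eq
          (ENNReal.pow_rpow_inv_natCast hn.ne' _)
      rw [htop] at this
      exact ENNReal.coe_ne_top (top_le_iff.1 this)
    · refine ENNReal.eq_top_of_forall_nnreal_le fun r => ?_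
      obtain ⟨m, hm⟩ := exists_nat_gt r
      obtain ⟨n, hn, hle⟩ := exists_pow_le_nthPolarizationConst hinf
        (m := m) (by exact_mod_cast (zero_le (a := r)).trans_lt hm)
      calc (r : ℝ≥0∞) ≤ m := by exact_mod_cast hm.le
        _ = ((m : ℝ≥0∞) ^ n) ^ ((n : ℝ)⁻¹) := (ENNReal.pow_rpow_inv_natCast hn.ne' _).symm
        _ ≤ nthPolarizationConst 𝕜 X n ^ (1 / (n : ℝ)) := by
          rw [one_div]
          exact ENNReal.rpow_le_rpow hle (by positivity)
        _ ≤ polarizationConst 𝕜 X := by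
          rw [hlim]
          exact le_iSup (fun n : ℕ => nthPolarizationConst 𝕜 X n ^ (1 / (n : ℝ))) n
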